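/- Fix $p\in(0,1]$, $\sigma\in\mathbb R$, $\tau\ge 0$, $L>0$, $c>0$, $\alpha<1$, and a real sequence $(C_d)_{d\ge 0}$ with $C_d\to\infty$ and $C_d/d\to 0$ as $d\to\infty$. Consider the following model for integers $n\ge d\ge 1$ with $n\le e^{d^\alpha}$ and $r\ge 0$. $M_0\in\mathbb R^{n\times d}$ has entries bounded by $L$ in absolute value and a singular value decomposition $M_0=U\Lambda V^T$, where $U\in\mathbb R^{n\times r}$ and $V\in\mathbb R^{d\times r}$ have orthonormal columns and $\Lambda=\mathrm{diag}(\lambda_1,\dots,\lambda_r)$ with $\lambda_i=b_i\sqrt{nd}$, $1/c\le b_i\le c$ (so $M_0$ has rank $r$). The entries of $\epsilon\in\mathbb R^{n\times d}$ are i.i.d. with mean $0$ and variance $\sigma^2$, and sub-Gaussian with variance proxy $\tau$: $\mathbb E e^{t\epsilon_{kh}}\le e^{\tau t^2/2}$ for all $t\in\mathbb R$. The entries of $y\in\{0,1\}^{n\times d}$ are i.i.d. Bernoulli($p$), and $y$ is independent of $\epsilon$. Let $M_{kh}=y_{kh}\,(M_{0,kh}+\epsilon_{kh})$ and $\hat\Sigma=M^TM$,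 let $\hat p=\frac1{nd}\sum_{k,h}y_{kh}$, and let $\hat\Sigma_{\hat p}=\hat\Sigma-(1-\hat p)\,\mathrm{diag}(\hat\Sigma)$, where $\mathrm{diag}(A)$ keeps the diagonal of $A$ and sets the other entries to $0$. Let $\hat r$ be the number of eigenvalues of $\hat\Sigma_{\hat p}$, counted with multiplicity, that are at least $p^2nC_d$. Then $\mathbb P(\hat r=r)=1-O(n^{-\delta})$ for every $\delta>0$, with a constant that is uniform over the model: for every $\delta>0$ there is a constant $K$, depending only on $p,\sigma,\tau,L,c,\alpha,(C_d)_d$ and $\delta$, such that for all such $n,d,r$ and all such $M_0$, $\epsilon$, $y$, $$\big|\mathbb P(\hat r=r)-1\big|\le K\,n^{-\delta}.$$ -/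

import Mathlib

open MeasureTheory ProbabilityTheory Filter Topology
open scoped NNReal Matrix

namespace LowRank

/-- `M₀` is an `n × d` matrix with entries bounded by `L` in absolute value and with a singular
value decomposition `M₀ = U Λ Vᵀ`, where `U`, `V` have `r` orthonormal columns and the singular
values are `λ i = b i * √(n d)` with `1 / c ≤ b i ≤ c`. -/
structure IsSignal {n d : ℕ} (r : ℕ) (L c : ℝ) (M₀ : Matrix (Fin n) (Fin d) ℝ) : Prop where
  bounded : ∀ k h, |M₀ k h| ≤ L
  svd : ∃ (U : Matrix (Fin n) (Fin r) ℝ) (V : Matrix (Fin d) (Fin r) ℝ) (b : Fin r → ℝ),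
    Uᵀ * U = 1 ∧ Vᵀ * V = 1 ∧ (∀ i, 1 / c ≤ b i ∧ b i ≤ c) ∧
      M₀ = U * Matrix.diagonal (fun i => b i * √((n : ℝ) * (d : ℝ))) * Vᵀ

/-- The entries of the random matrix `ε` are i.i.d. sub-Gaussian (with variance proxy `τ`),
with mean zero and variance `σ ^ 2`. -/
structure IsNoise {Ω : Type*} [MeasurableSpace Ω] (P : Measure Ω) {n d : ℕ} (σ : ℝ) (τ : ℝ≥0)
    (ε : Ω → Matrix (Fin n) (Fin d) ℝ) : Prop where
  measurable : ∀ k h, Measurable fun ω => ε ω k h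
  indep : iIndepFun (fun (e : Fin n × Fin d) ω => ε ω e.1 e.2) P
  identDistrib : ∀ k h k' h', IdentDistrib (fun ω => ε ω k h) (fun ω => ε ω k' h') P P
  subgaussian : ∀ k h, HasSubgaussianMGF (fun ω => ε ω k h) τ P
  mean : ∀ k h, ∫ ω, ε ω k h ∂P = 0
  variance : ∀ k h, ProbabilityTheory.variance (fun ω => ε ω k h) P = σ ^ 2

/-- The entries of the random `{0,1}`-matrix `y` are i.i.d. Bernoulli(`p`). -/
structure IsMask {Ω : Type*} [MeasurableSpace Ω] (P : Measure Ω) {n d : ℕ} (p : ℝ)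
    (y : Ω → Matrix (Fin n) (Fin d) ℝ) : Prop where
  measurable : ∀ k h, Measurable fun ω => y ω k h
  zero_or_one : ∀ ω k h, y ω k h = 0 ∨ y ω k h = 1
  prob_one : ∀ k h, P.real {ω | y ω k h = 1} = p
  indep : iIndepFun (fun (e : Fin n × Fin d) ω => y ω e.1 e.2) P

/-- The partially observed matrix `M`, with entries `y k h * (M₀ k h + ε k h)`. -/
def observed {n d : ℕ} (M₀ ε y : Matrix (Fin n) (Fin d) ℝ) : Matrix (Fin n) (Fin d) ℝ :=
  y ⊙ (M₀ + ε)

/-- The proportion `p̂` of observed entries. -/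
noncomputable def pHat {n d : ℕ} (y : Matrix (Fin n) (Fin d) ℝ) : ℝ :=
  (∑ k, ∑ h, y k h) / ((n : ℝ) * (d : ℝ))

/-- The bias-adjusted matrix `Σ̂_p̂ = MᵀM - (1 - p̂) diag(MᵀM)`. -/
noncomputable def sigmaHat {n d : ℕ} (M y : Matrix (Fin n) (Fin d) ℝ) :
    Matrix (Fin d) (Fin d) ℝ :=
  Mᵀ * M - (1 - pHat y) • Matrix.diagonal (Mᵀ * M).diag

theorem sigmaHat_isHermitian {n d : ℕ} (M y : Matrix (Fin n) (Fin d) ℝ) :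
    (sigmaHat M y).IsHermitian := by
  unfold Matrix.IsHermitian sigmaHat
  simp [Matrix.conjTranspose_eq_transpose_of_trivial, Matrix.transpose_mul]

/-- The rank estimator `r̂`: the number of eigenvalues of `Σ̂_p̂`, counted with multiplicity,
that are at least `p² n C`. -/
noncomputable def rankEstimator {n d : ℕ} (p C : ℝ) (M y : Matrix (Fin n) (Fin d) ℝ) : ℕ :=
  (Finset.univ.filter fun i : Fin d =>
    p ^ 2 * (n : ℝ) * C ≤ (sigmaHat_isHermitian M y).eigenvalues i).card

end LowRank

/-!
Write `M = p M₀ + Z`, where `Z = M - p M₀` is centred. Unit-norm linear forms of `Z` are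
sub-Gaussian with a constant proxy `s` (`hasSubgaussianMGF_centered`), so that a net argument on
both unit spheres gives `‖Z‖² ≤ 160 s n` outside an event of probability `exp (-n)`
(`exists_event_centered_bound`). Everything else happens on this event.

The cross terms `M₀ᵀ Z` in `Mᵀ M` can have norm of order `d √n`, which for `n` close to `d` may
exceed the threshold `p² n C_d`. A perturbation bound for `Σ̂_p̂` is therefore not enough, and the
two sides of the threshold are treated by min-max (`card_filter_eigenvalues_eq`):

* on the kernel of `M₀`, of codimension `r`, one has `M x = Z x`, the cross terms vanish, and the
  diagonal correction only lowers the quadratic form, which is thus at most `160 s n ‖x‖²`;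
* on the row space of `M₀`, of dimension `r`, one has `‖M x‖² ≥ p² ‖M₀ x‖² / 2 - ‖Z x‖²`, which is
  of order `n d ‖x‖²`, while the diagonal correction is at most `O(n) ‖x‖²`.

As `C_d → ∞` and `C_d / d → 0`, for large `d` the threshold falls strictly between the two bounds.
Of `p̂` only `0 ≤ p̂ ≤ 1` is needed. For bounded `d`, the condition `n ≤ exp (d ^ α)` bounds `n`, and
the claim holds with a large constant.
-/

namespace LowRank

/-! ### Sub-Gaussian linear forms of the centred matrix -/

theorem hasSubgaussianMGF_mono {Ω : Type*} [MeasurableSpace Ω] {P : Measure Ω} {X : Ω → ℝ}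
    {s t : ℝ≥0} (h : HasSubgaussianMGF X s P) (hst : s ≤ t) : HasSubgaussianMGF X t P where
  integrable_exp_mul := h.integrable_exp_mul
  mgf_le u := (h.mgf_le u).trans <| by
    have : (s : ℝ) ≤ t := hst
    gcongr

/-- If `g (X, b)` is sub-Gaussian with the same proxy for every frozen value `b` of the independent
variable `Y`, then so is `g (X, Y)`: integrate the exponential moments over the law of `Y`. -/
theorem hasSubgaussianMGF_of_indepFun {Ω A B : Type*} [MeasurableSpace Ω] [MeasurableSpace A]
    [MeasurableSpace B] {P : Measure Ω} [IsProbabilityMeasure P] {X : Ω → A} {Y : Ω → B}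
    (hX : Measurable X) (hY : Measurable Y) (hXY : IndepFun X Y P) {g : A → B → ℝ}
    (hg : Measurable (Function.uncurry g)) {s : ℝ≥0}
    (hs : ∀ b, HasSubgaussianMGF (fun ω => g (X ω) b) s P) :
    HasSubgaussianMGF (fun ω => g (X ω) (Y ω)) s P := by
  have : IsProbabilityMeasure (P.map X) := Measure.isProbabilityMeasure_map hX.aemeasurable
  have : IsProbabilityMeasure (P.map Y) := Measure.isProbabilityMeasure_map hY.aemeasurable
  have hlaw : P.map (fun ω => (X ω, Y ω)) = (P.map X).prod (P.map Y) :=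
    (indepFun_iff_map_prod_eq_prod_map_map hX.aemeasurable hY.aemeasurable).1 hXY
  have hmeas : ∀ t : ℝ, Measurable fun z : A × B => Real.exp (t * g z.1 z.2) := fun t =>
    Real.measurable_exp.comp (measurable_const.mul hg)
  have hmeas' : ∀ (t : ℝ) (b : B), Measurable fun x : A => Real.exp (t * g x b) := fun t b =>
    (hmeas t).comp (measurable_id.prodMk measurable_const)
  have hsec : ∀ t b, ∫ x, Real.exp (t * g x b) ∂(P.map X) ≤ Real.exp (s * t ^ 2 / 2) := by
    intro t b
    rw [integral_map hX.aemeasurable (hmeas' t b).aestronglyMeasurable]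
    exact (hs b).mgf_le t
  have hint : ∀ t, Integrable (fun z : A × B => Real.exp (t * g z.1 z.2))
      ((P.map X).prod (P.map Y)) := by
    intro t
    rw [integrable_prod_iff' (hmeas t).aestronglyMeasurable]
    refine ⟨ae_of_all _ fun b => ?_, ?_⟩
    · exact (integrable_map_measure (hmeas' t b).aestronglyMeasurable hX.aemeasurable).2
        ((hs b).integrable_exp_mul t)
    · refine Integrable.mono' (integrable_const (Real.exp (s * t ^ 2 / 2))) ?_
        (ae_of_all _ fun b => ?_)
      · exact (hmeas t).norm.stronglyMeasurable.integral_prod_left'.aestronglyMeasurable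
      · rw [Real.norm_of_nonneg (integral_nonneg fun _ => norm_nonneg _)]
        simpa only [Real.norm_of_nonneg (Real.exp_pos _).le] using hsec t b
  refine ⟨fun t => ?_, fun t => ?_⟩
  · have h := hint t
    rw [← hlaw] at h
    exact (integrable_map_measure (hmeas t).aestronglyMeasurable
      (hX.prodMk hY).aemeasurable).1 h
  · have h : mgf (fun ω => g (X ω) (Y ω)) P t
        = ∫ z, Real.exp (t * g z.1 z.2) ∂((P.map X).prod (P.map Y)) := by
      rw [← hlaw, integral_map (hX.prodMk hY).aemeasurable (hmeas t).aestronglyMeasurable]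
      rfl
    rw [h, integral_prod_symm _ (hint t)]
    calc ∫ b, ∫ x, Real.exp (t * g x b) ∂(P.map X) ∂(P.map Y)
        ≤ ∫ _, Real.exp (s * t ^ 2 / 2) ∂(P.map Y) :=
          integral_mono (hint t).integral_prod_right (integrable_const _) (hsec t)
      _ = _ := by simp

theorem hasSubgaussianMGF_linear {Ω ι : Type*} [MeasurableSpace Ω] [Fintype ι] {P : Measure Ω}
    {X : ι → Ω → ℝ} (hX : iIndepFun X P) {s : ℝ≥0} (hs : ∀ e, HasSubgaussianMGF (X e) s P)
    {a : ι → ℝ} (ha : ∑ e, a e ^ 2 ≤ 1) :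
    HasSubgaussianMGF (fun ω => ∑ e, a e * X e ω) s P := by
  refine hasSubgaussianMGF_mono (HasSubgaussianMGF.sum_of_iIndepFun
    (X := fun e ω => a e * X e ω) (s := Finset.univ)
    (hX.comp (fun e x => a e * x) fun e => measurable_const.mul measurable_id)
    fun e _ => (hs e).const_mul (a e)) ?_
  rw [← NNReal.coe_le_coe, NNReal.coe_sum]
  calc ∑ e, a e ^ 2 * (s : ℝ) = (∑ e, a e ^ 2) * s := (Finset.sum_mul ..).symm
    _ ≤ s := mul_le_of_le_one_left s.2 ha

/-- Unit-norm linear forms of `Z = M - p M₀` are sub-Gaussian with a proxy free of the dimensions.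
The entry `Z k h` is the sum of the noise part `y k h * ε k h` and the mask part
`M₀ k h * (y k h - p)`; the two parts are dependent, so their proxies combine as
`(√τ + L) ^ 2`. -/
theorem hasSubgaussianMGF_centered {n d : ℕ} {Ω : Type*} [MeasurableSpace Ω] {P : Measure Ω}
    [IsProbabilityMeasure P] {p σ L : ℝ} {τ : ℝ≥0} (hL : 0 < L)
    {M₀ : Matrix (Fin n) (Fin d) ℝ} (hM₀ : ∀ k h, |M₀ k h| ≤ L)
    {ε y : Ω → Matrix (Fin n) (Fin d) ℝ} (hε : IsNoise P σ τ ε) (hy : IsMask P p y)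
    (hεy : IndepFun (fun ω (e : Fin n × Fin d) => ε ω e.1 e.2)
      (fun ω (e : Fin n × Fin d) => y ω e.1 e.2) P)
    {a : Fin n × Fin d → ℝ} (ha : ∑ e, a e ^ 2 ≤ 1) :
    HasSubgaussianMGF
      (fun ω => ∑ e : Fin n × Fin d, a e * (observed M₀ (ε ω) (y ω) - p • M₀) e.1 e.2)
      ((τ.sqrt + L.toNNReal) ^ 2) P := by
  have hmeanY : ∀ k h, ∫ ω, y ω k h ∂P = p := by
    intro k h
    have hset : MeasurableSet {ω | y ω k h = 1} := hy.measurable k h (measurableSet_singleton 1)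
    have : (fun ω => y ω k h) = Set.indicator {ω | y ω k h = 1} fun _ => (1 : ℝ) := by
      ext ω
      rcases hy.zero_or_one ω k h with h0 | h1
      · simp [Set.indicator, h0]
      · simp [Set.indicator, h1]
    rw [this, integral_indicator_const _ hset, hy.prob_one]
    simp
  -- The mask contribution is a weighted sum of independent bounded centred variables.
  have hmask : HasSubgaussianMGF
      (fun ω => ∑ e : Fin n × Fin d, a e * (M₀ e.1 e.2 * (y ω e.1 e.2 - p))) (L.toNNReal ^ 2) P := by
    refine hasSubgaussianMGF_linear (X := fun e ω => M₀ e.1 e.2 * (y ω e.1 e.2 - p))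
      (hy.indep.comp (fun e x => M₀ e.1 e.2 * (x - p)) fun e => by fun_prop) (fun e => ?_) ha
    have h := hasSubgaussianMGF_of_mem_Icc (μ := P) (X := fun ω => M₀ e.1 e.2 * y ω e.1 e.2)
      (a := -L) (b := L) ((hy.measurable e.1 e.2).const_mul _).aemeasurable
      (ae_of_all _ fun ω => by
        have := abs_le.1 (hM₀ e.1 e.2)
        rcases hy.zero_or_one ω e.1 e.2 with h0 | h1
        · simp [h0, hL.le]
        · simpa [h1] using this)
    rw [integral_const_mul, hmeanY] at h
    refine hasSubgaussianMGF_mono (by simpa only [mul_sub] using h) (le_of_eq ?_)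
    ext
    simp [abs_of_pos hL, hL.le, ← two_mul]
  -- Conditionally on the mask, the noise contribution is a weighted sum of independent variables
  -- with weights no larger than the `a e`.
  have hnoise : HasSubgaussianMGF
      (fun ω => ∑ e : Fin n × Fin d, a e * (y ω e.1 e.2 * ε ω e.1 e.2)) τ P := by
    have h := hasSubgaussianMGF_of_indepFun (P := P) (s := τ)
      (g := fun (x b : Fin n × Fin d → ℝ) => ∑ e, (a e * if b e = 1 then 1 else 0) * x e)
      (measurable_pi_lambda _ fun e : Fin n × Fin d => hε.measurable e.1 e.2)
      (measurable_pi_lambda _ fun e : Fin n × Fin d => hy.measurable e.1 e.2) hεy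
      (by
        refine Finset.measurable_sum _ fun e _ => ?_
        refine (measurable_const.mul (Measurable.ite ?_ measurable_const measurable_const)).mul
          (by fun_prop)
        exact ((measurable_pi_apply e).comp measurable_snd) (measurableSet_singleton 1))
      (fun b => by
        refine hasSubgaussianMGF_linear (X := fun (e : Fin n × Fin d) ω => ε ω e.1 e.2) hε.indep
          (fun e => hε.subgaussian e.1 e.2) (le_trans (Finset.sum_le_sum fun e _ => ?_) ha)
        split_ifs
        · simp
        · simpa using sq_nonneg (a e))
    refine h.congr (ae_of_all _ fun ω => Finset.sum_congr rfl fun e _ => ?_)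
    rcases hy.zero_or_one ω e.1 e.2 with h0 | h1
    · simp [h0]
    · simp [h1]
  have h := hnoise.add hmask
  rw [NNReal.sqrt_sq] at h
  refine h.congr (ae_of_all _ fun ω => ?_)
  simp only [observed, Matrix.sub_apply, Matrix.hadamard_apply, Matrix.add_apply,
    Matrix.smul_apply, smul_eq_mul, ← Finset.sum_add_distrib]
  exact Finset.sum_congr rfl fun e _ => by ring

/-! ### Nets and operator norms -/

/-- The unit ball of a finite-dimensional space has a `1/2`-net of at most `5 ^ dim` points, namely
a `1/2`-separated set of largest cardinality. -/
theorem exists_half_net (E : Type*) [NormedAddCommGroup E] [NormedSpace ℝ E]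
    [FiniteDimensional ℝ E] :
    ∃ s : Finset E, s.card ≤ 5 ^ Module.finrank ℝ E ∧ (∀ x ∈ s, ‖x‖ ≤ 1) ∧
      ∀ x : E, ‖x‖ ≤ 1 → ∃ z ∈ s, ‖x - z‖ ≤ 1 / 2 := by
  classical
  let Sep : Finset E → Prop := fun s =>
    (∀ x ∈ s, ‖x‖ ≤ 1) ∧ ∀ x ∈ s, ∀ z ∈ s, x ≠ z → 1 / 2 ≤ ‖x - z‖
  have hcard : ∀ s, Sep s → s.card ≤ 5 ^ Module.finrank ℝ E := by
    intro s hs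
    -- The cardinality bound is for `1`-separated sets in the ball of radius `2`.
    have hinj : Function.Injective fun x : E => (2 : ℝ) • x :=
      smul_right_injective E two_ne_zero
    rw [← Finset.card_image_of_injective s hinj]
    refine Besicovitch.card_le_of_separated _ ?_ ?_
    · simp only [Finset.forall_mem_image, norm_smul]
      intro x hx
      have := hs.1 x hx
      norm_num
      linarith
    · simp only [Finset.forall_mem_image]
      intro x hx z hz hne
      have := hs.2 x hx z hz fun h => hne (by rw [h])
      rw [← smul_sub, norm_smul]
      norm_num
      linarith
  let p : ℕ → Prop := fun k => ∃ s, Sep s ∧ s.card = k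
  obtain ⟨s, hs, hsk⟩ : p (Nat.findGreatest p (5 ^ Module.finrank ℝ E)) :=
    Nat.findGreatest_spec (Nat.zero_le _) ⟨∅, by simp [Sep], rfl⟩
  refine ⟨s, hcard s hs, hs.1, fun x hx => ?_⟩
  by_contra! hcon
  have hxs : x ∉ s := fun h => by
    have := hcon x h
    norm_num at this
  have hs' : Sep (insert x s) := by
    refine ⟨by simpa [hx] using hs.1, ?_⟩
    simp only [Finset.mem_insert]
    rintro u (rfl | hu) v (rfl | hv) huv
    · exact absurd rfl huv
    · exact (hcon v hv).le
    · rw [norm_sub_rev]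
      exact (hcon u hu).le
    · exact hs.2 u hu v hv huv
  have := Nat.le_findGreatest (P := p) (hcard _ hs') ⟨_, hs', rfl⟩
  rw [Finset.card_insert_of_notMem hxs] at this
  omega

theorem norm_le_of_half_net {E : Type*} [NormedAddCommGroup E] [InnerProductSpace ℝ E]
    {s : Finset E} (hs : ∀ x : E, ‖x‖ ≤ 1 → ∃ z ∈ s, ‖x - z‖ ≤ 1 / 2) {w : E} {t : ℝ}
    (h : ∀ z ∈ s, inner ℝ z w ≤ t) : ‖w‖ ≤ 2 * t := by
  obtain ⟨z, hz, hxz⟩ := hs (‖w‖⁻¹ • w) (by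
    rw [norm_smul, norm_inv, norm_norm]
    exact inv_mul_le_one)
  have h1 : inner ℝ (‖w‖⁻¹ • w) w = ‖w‖ := by
    rw [real_inner_smul_left, real_inner_self_eq_norm_sq]
    rcases eq_or_ne ‖w‖ 0 with h0 | h0
    · simp [h0]
    · field_simp
  have h2 : inner ℝ (‖w‖⁻¹ • w - z) w ≤ 1 / 2 * ‖w‖ :=
    (real_inner_le_norm _ _).trans (by gcongr)
  rw [inner_sub_left, h1] at h2
  linarith [h z hz]

theorem opNorm_le_of_half_net {E F : Type*} [NormedAddCommGroup E] [NormedSpace ℝ E]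
    [NormedAddCommGroup F] [InnerProductSpace ℝ F]
    {s : Finset E} (hs : ∀ x : E, ‖x‖ ≤ 1 → ∃ z ∈ s, ‖x - z‖ ≤ 1 / 2)
    {s' : Finset F} (hs' : ∀ x : F, ‖x‖ ≤ 1 → ∃ z ∈ s', ‖x - z‖ ≤ 1 / 2)
    (A : E →L[ℝ] F) {t : ℝ} (ht : 0 ≤ t) (h : ∀ x ∈ s, ∀ z ∈ s', inner ℝ z (A x) ≤ t) :
    ‖A‖ ≤ 4 * t := by
  have hA : ‖A‖ ≤ 2 * t + ‖A‖ / 2 := by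
    refine A.opNorm_le_of_unit_norm (by positivity) fun x hx => ?_
    obtain ⟨z, hz, hxz⟩ := hs x hx.le
    calc ‖A x‖ = ‖A z + A (x - z)‖ := by simp
      _ ≤ ‖A z‖ + ‖A‖ * ‖x - z‖ := (norm_add_le _ _).trans (by gcongr; exact A.le_opNorm _)
      _ ≤ 2 * t + ‖A‖ * (1 / 2) := by
        gcongr
        exact norm_le_of_half_net hs' (h z hz)
      _ = _ := by ring
  linarith

/-! ### Counting eigenvalues -/

theorem dotProduct_self_eq_norm_sq {d : ℕ} (x : EuclideanSpace ℝ (Fin d)) :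
    x.ofLp ⬝ᵥ x.ofLp = ‖x‖ ^ 2 := by
  rw [EuclideanSpace.real_norm_sq_eq]
  simp [dotProduct, sq]

theorem dotProduct_mulVec_eigenvectors {d : ℕ} {A : Matrix (Fin d) (Fin d) ℝ}
    (hA : A.IsHermitian) (x : EuclideanSpace ℝ (Fin d)) :
    x.ofLp ⬝ᵥ A *ᵥ x.ofLp
      = ∑ i, hA.eigenvalues i * inner ℝ (hA.eigenvectorBasis i) x ^ 2 := by
  have hx : A *ᵥ x.ofLp = (∑ i, (inner ℝ (hA.eigenvectorBasis i) x * hA.eigenvalues i) •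
      hA.eigenvectorBasis i : EuclideanSpace ℝ (Fin d)).ofLp := by
    conv_lhs => rw [← hA.eigenvectorBasis.sum_repr' x]
    rw [WithLp.ofLp_sum, WithLp.ofLp_sum, Matrix.mulVec_sum]
    refine Finset.sum_congr rfl fun i _ => ?_
    rw [WithLp.ofLp_smul, WithLp.ofLp_smul, Matrix.mulVec_smul, hA.mulVec_eigenvectorBasis,
      smul_smul]
  have hin : x.ofLp ⬝ᵥ A *ᵥ x.ofLp = inner ℝ (∑ i, (inner ℝ (hA.eigenvectorBasis i) x *
      hA.eigenvalues i) • hA.eigenvectorBasis i : EuclideanSpace ℝ (Fin d)) x := by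
    rw [hx, EuclideanSpace.inner_eq_star_dotProduct]
    simp
  rw [hin, sum_inner]
  refine Finset.sum_congr rfl fun i _ => ?_
  rw [real_inner_smul_left]
  ring

theorem dotProduct_self_eigenvectors {d : ℕ} {A : Matrix (Fin d) (Fin d) ℝ}
    (hA : A.IsHermitian) (x : EuclideanSpace ℝ (Fin d)) :
    x.ofLp ⬝ᵥ x.ofLp = ∑ i, inner ℝ (hA.eigenvectorBasis i) x ^ 2 := by
  rw [dotProduct_self_eq_norm_sq, ← hA.eigenvectorBasis.sum_sq_norm_inner_right]
  simp

/-- Fewer than `dim W` linear conditions leave a nonzero vector in `W`. -/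
theorem exists_ne_zero_inner_eq_zero {E ι : Type*} [NormedAddCommGroup E]
    [InnerProductSpace ℝ E] [FiniteDimensional ℝ E] (b : ι → E) (s : Finset ι)
    {W : Submodule ℝ E} (h : s.card < Module.finrank ℝ W) :
    ∃ x ∈ W, x ≠ 0 ∧ ∀ i ∈ s, inner ℝ (b i) x = 0 := by
  let f : W →ₗ[ℝ] (s → ℝ) := LinearMap.pi fun i => (innerₛₗ ℝ (b i)).comp W.subtype
  have hf : LinearMap.ker f ≠ ⊥ := LinearMap.ker_ne_bot_of_finrank_lt (by simpa using h)
  obtain ⟨x, hx, hx0⟩ := Submodule.exists_mem_ne_zero_of_ne_bot hf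
  refine ⟨x, x.2, by simpa using hx0, fun i hi => ?_⟩
  simpa [f] using congrFun (LinearMap.mem_ker.1 hx) ⟨i, hi⟩

/-- Min-max counting of eigenvalues: if the quadratic form of `A` is at least `T` on the range of `V`
and below `T` on the orthogonal complement of that range, then exactly `r = rank V` eigenvalues
are at least `T`. -/
theorem card_filter_eigenvalues_eq {d r : ℕ} {A : Matrix (Fin d) (Fin d) ℝ}
    (hA : A.IsHermitian) {V : Matrix (Fin d) (Fin r) ℝ} (hV : Vᵀ * V = 1) {T : ℝ}
    (hlow : ∀ a : Fin r → ℝ, T * ((V *ᵥ a) ⬝ᵥ (V *ᵥ a)) ≤ (V *ᵥ a) ⬝ᵥ A *ᵥ (V *ᵥ a))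
    (hupp : ∀ x : Fin d → ℝ, x ≠ 0 → Vᵀ *ᵥ x = 0 → x ⬝ᵥ A *ᵥ x < T * (x ⬝ᵥ x)) :
    (Finset.univ.filter fun i => T ≤ hA.eigenvalues i).card = r := by
  classical
  let b := hA.eigenvectorBasis
  apply le_antisymm
  · by_contra! hcon
    -- Some nonzero vector is orthogonal to the columns of `V` and to all eigenvectors with
    -- eigenvalue below `T`.
    let col : Fin r → EuclideanSpace ℝ (Fin d) := fun j => WithLp.toLp 2 (V.col j)
    let S := Finset.univ.filter fun i => ¬ T ≤ hA.eigenvalues i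
    have hS : (Finset.univ.filter fun i => T ≤ hA.eigenvalues i).card + S.card = d := by
      rw [Finset.card_filter_add_card_filter_not, Finset.card_univ, Fintype.card_fin]
    obtain ⟨x, -, hx0, hx⟩ := exists_ne_zero_inner_eq_zero (Sum.elim b col)
      (S.disjSum Finset.univ) (W := (⊤ : Submodule ℝ (EuclideanSpace ℝ (Fin d)))) (by
        rw [Finset.card_disjSum, finrank_top]
        simp
        omega)
    have hVx : Vᵀ *ᵥ x.ofLp = 0 := by
      ext j
      have := hx (Sum.inr j) (by simp)
      simpa [col, EuclideanSpace.inner_eq_star_dotProduct, Matrix.mulVec, dotProduct_comm]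
        using! this
    have h := hupp x.ofLp (by simpa using hx0) hVx
    rw [dotProduct_mulVec_eigenvectors hA, dotProduct_self_eigenvectors hA, Finset.mul_sum] at h
    refine absurd h (not_lt.2 (Finset.sum_le_sum fun i _ => ?_))
    by_cases hi : T ≤ hA.eigenvalues i
    · gcongr
    · have : inner ℝ (hA.eigenvectorBasis i) x = 0 :=
        hx (Sum.inl i) (by simpa [S] using hi)
      simp [this]
  · by_contra! hcon
    -- Some nonzero vector in the range of `V` is orthogonal to all eigenvectors with
    -- eigenvalue at least `T`.
    let f : (Fin r → ℝ) →ₗ[ℝ] EuclideanSpace ℝ (Fin d) :=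
      (WithLp.linearEquiv 2 ℝ (Fin d → ℝ)).symm.toLinearMap ∘ₗ V.mulVecLin
    have hf : Function.Injective f := by
      refine (WithLp.linearEquiv 2 ℝ (Fin d → ℝ)).symm.injective.comp fun a a' h => ?_
      have h' : Vᵀ *ᵥ (V *ᵥ a) = Vᵀ *ᵥ (V *ᵥ a') := congrArg _ h
      simpa [Matrix.mulVec_mulVec, hV] using h'
    obtain ⟨x, ⟨a, rfl⟩, hx0, hx⟩ := exists_ne_zero_inner_eq_zero b
      (Finset.univ.filter fun i => T ≤ hA.eigenvalues i) (W := LinearMap.range f) (by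
        rw [LinearMap.finrank_range_of_inj hf]
        simpa using hcon)
    have h := hlow a
    change T * ((f a).ofLp ⬝ᵥ (f a).ofLp) ≤ (f a).ofLp ⬝ᵥ A *ᵥ (f a).ofLp at h
    rw [dotProduct_mulVec_eigenvectors hA, dotProduct_self_eigenvectors hA, Finset.mul_sum] at h
    refine absurd h (not_le.2 ?_)
    have hle : ∀ i, hA.eigenvalues i * inner ℝ (hA.eigenvectorBasis i) (f a) ^ 2
        ≤ T * inner ℝ (hA.eigenvectorBasis i) (f a) ^ 2 := by
      intro i
      by_cases hi : T ≤ hA.eigenvalues i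
      · have : inner ℝ (hA.eigenvectorBasis i) (f a) = 0 := hx i (by simpa using hi)
        simp [this]
      · have := (not_le.1 hi).le
        gcongr
    obtain ⟨i, hi⟩ : ∃ i, inner ℝ (b i) (f a) ≠ 0 := by
      by_contra! h0
      refine hx0 ?_
      rw [← b.sum_repr' (f a)]
      exact Finset.sum_eq_zero fun i _ => by rw [h0 i, zero_smul]
    refine Finset.sum_lt_sum (fun i _ => hle i) ⟨i, Finset.mem_univ i, ?_⟩
    have hlt : hA.eigenvalues i < T := by
      by_contra! hT
      exact hi (hx i (by simpa using hT))
    have hi' : 0 < inner ℝ (hA.eigenvectorBasis i) (f a) ^ 2 := by positivity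
    gcongr

/-! ### The estimator under a bound on the centred matrix -/

theorem mulVec_dotProduct_mulVec_of_orthonormal {m r : ℕ} {U : Matrix (Fin m) (Fin r) ℝ}
    (hU : Uᵀ * U = 1) (a : Fin r → ℝ) : (U *ᵥ a) ⬝ᵥ (U *ᵥ a) = a ⬝ᵥ a := by
  rw [Matrix.dotProduct_mulVec, Matrix.vecMul_mulVec, hU, Matrix.vecMul_one]

theorem dotProduct_sigmaHat_mulVec {n d : ℕ} (M y : Matrix (Fin n) (Fin d) ℝ) (x : Fin d → ℝ) :
    x ⬝ᵥ sigmaHat M y *ᵥ x = (M *ᵥ x) ⬝ᵥ (M *ᵥ x)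
      - (1 - pHat y) * ∑ h, (∑ k, M k h ^ 2) * x h ^ 2 := by
  have h1 : x ⬝ᵥ (Mᵀ * M) *ᵥ x = (M *ᵥ x) ⬝ᵥ (M *ᵥ x) := by
    rw [Matrix.dotProduct_mulVec (M *ᵥ x), Matrix.vecMul_mulVec, ← Matrix.dotProduct_mulVec]
  have h2 : x ⬝ᵥ Matrix.diagonal (Mᵀ * M).diag *ᵥ x = ∑ h, (∑ k, M k h ^ 2) * x h ^ 2 := by
    simp only [dotProduct, Matrix.mulVec_diagonal, Matrix.diag_apply, Matrix.mul_apply,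
      Matrix.transpose_apply, ← sq]
    exact Finset.sum_congr rfl fun h _ => by ring
  rw [sigmaHat, Matrix.sub_mulVec, dotProduct_sub, Matrix.smul_mulVec, dotProduct_smul,
    smul_eq_mul, h1, h2]

theorem pHat_mem_Icc {n d : ℕ} {y : Matrix (Fin n) (Fin d) ℝ}
    (hy : ∀ k h, y k h = 0 ∨ y k h = 1) : pHat y ∈ Set.Icc (0 : ℝ) 1 := by
  have h0 : ∀ k h, 0 ≤ y k h := fun k h => by rcases hy k h with h | h <;> simp [h]
  have h1 : ∀ k h, y k h ≤ 1 := fun k h => by rcases hy k h with h | h <;> simp [h]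
  refine ⟨div_nonneg (Finset.sum_nonneg fun k _ => Finset.sum_nonneg fun h _ => h0 k h)
    (by positivity), div_le_one_of_le₀ ?_ (by positivity)⟩
  calc ∑ k, ∑ h, y k h ≤ ∑ _k : Fin n, ∑ _h : Fin d, (1 : ℝ) :=
        Finset.sum_le_sum fun k _ => Finset.sum_le_sum fun h _ => h1 k h
    _ = n * d := by simp

/-- The deterministic part: if `‖M - p M₀‖² ≤ B` and the threshold is separated from `B` and from the
signal strength, then the estimator returns the rank. -/
theorem rankEstimator_eq_of_centered_bound {n d r : ℕ} {p L c B T : ℝ} (hp1 : p ^ 2 ≤ 1)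
    (hc : 0 < c) {M₀ ε y : Matrix (Fin n) (Fin d) ℝ} (hM₀ : IsSignal r L c M₀)
    (hy : ∀ k h, y k h = 0 ∨ y k h = 1)
    (hZ : ∀ x : Fin d → ℝ, ((observed M₀ ε y - p • M₀) *ᵥ x) ⬝ᵥ
      ((observed M₀ ε y - p • M₀) *ᵥ x) ≤ B * (x ⬝ᵥ x))
    (hupp : B < p ^ 2 * n * T)
    (hlow : p ^ 2 * n * T ≤ p ^ 2 * (n * d) / (2 * c ^ 2) - 3 * B - 2 * L ^ 2 * n) :
    rankEstimator p T (observed M₀ ε y) y = r := by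
  obtain ⟨hbdd, U, V, b, hU, hV, hb, hsvd⟩ := hM₀
  obtain ⟨hq0, hq1⟩ := pHat_mem_Icc hy
  set M := observed M₀ ε y with hM
  set Z := M - p • M₀ with hZdef
  have hMZ : M = Z + p • M₀ := by simp [hZdef]
  have hnn : ∀ {m : ℕ} (x : Fin m → ℝ), 0 ≤ x ⬝ᵥ x := fun x =>
    Finset.sum_nonneg fun i _ => mul_self_nonneg _
  have hM₀mul : ∀ x, M₀ *ᵥ x = U *ᵥ ((fun i => b i * √((n : ℝ) * d)) * (Vᵀ *ᵥ x)) := by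
    intro x
    rw [hsvd, ← Matrix.mulVec_mulVec, ← Matrix.mulVec_mulVec]
    congr 1
    ext i
    rw [Matrix.mulVec_diagonal, Pi.mul_apply]
  refine card_filter_eigenvalues_eq _ hV (fun a => ?_) (fun x hx0 hx => ?_)
  · set x := V *ᵥ a with hxdef
    have hxx : x ⬝ᵥ x = a ⬝ᵥ a := mulVec_dotProduct_mulVec_of_orthonormal hV a
    -- The signal expands the range of `V` by at least `√(n d) / c`.
    have hsig : n * d / c ^ 2 * (x ⬝ᵥ x) ≤ (M₀ *ᵥ x) ⬝ᵥ (M₀ *ᵥ x) := by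
      rw [hM₀mul, mulVec_dotProduct_mulVec_of_orthonormal hU, hxdef, Matrix.mulVec_mulVec, hV,
        Matrix.one_mulVec, ← hxdef, hxx, dotProduct, dotProduct, Finset.mul_sum]
      refine Finset.sum_le_sum fun i _ => ?_
      have hbi : 1 / c ^ 2 ≤ b i ^ 2 := by
        rw [← one_div_pow]
        exact pow_le_pow_left₀ (by positivity) (hb i).1 2
      have hsq : √((n : ℝ) * d) ^ 2 = n * d := Real.sq_sqrt (by positivity)
      calc (n : ℝ) * d / c ^ 2 * (a i * a i) = 1 / c ^ 2 * (n * d * a i ^ 2) := by ring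
        _ ≤ b i ^ 2 * (n * d * a i ^ 2) := by gcongr
        _ = b i ^ 2 * (√((n : ℝ) * d) ^ 2 * a i ^ 2) := by rw [hsq]
        _ = _ := by
          simp only [Pi.mul_apply]
          ring
    have hMx : p ^ 2 / 2 * ((M₀ *ᵥ x) ⬝ᵥ (M₀ *ᵥ x)) - B * (x ⬝ᵥ x)
        ≤ (M *ᵥ x) ⬝ᵥ (M *ᵥ x) := by
      refine le_trans (sub_le_sub_left (hZ x) _) ?_
      rw [hMZ, Matrix.add_mulVec, Matrix.smul_mulVec]
      simp only [dotProduct, Finset.mul_sum, ← Finset.sum_sub_distrib]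
      refine Finset.sum_le_sum fun i _ => ?_
      simp only [Pi.add_apply, Pi.smul_apply, smul_eq_mul]
      -- `(z + m)² ≥ m² / 2 - z²`, the difference being `(m + 2 z)² / 2`.
      nlinarith [sq_nonneg (p * (M₀ *ᵥ x) i + 2 * (Z *ᵥ x) i)]
    have hcol : ∀ h, ∑ k, M k h ^ 2 ≤ 2 * B + 2 * L ^ 2 * n := by
      intro h
      have h1 : ∑ k, Z k h ^ 2 ≤ B := by
        have := hZ (Pi.single h 1)
        simpa [dotProduct, ← sq, Pi.single_apply] using this
      calc ∑ k, M k h ^ 2 ≤ ∑ k, (2 * Z k h ^ 2 + 2 * L ^ 2) := by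
            refine Finset.sum_le_sum fun k _ => ?_
            have h2 : M₀ k h ^ 2 ≤ L ^ 2 := sq_le_sq' (abs_le.1 (hbdd k h)).1
              (abs_le.1 (hbdd k h)).2
            have h3 : p ^ 2 * M₀ k h ^ 2 ≤ 1 * L ^ 2 := by gcongr
            rw [hMZ, Matrix.add_apply, Matrix.smul_apply, smul_eq_mul]
            nlinarith [sq_nonneg (Z k h - p * M₀ k h)]
        _ = 2 * ∑ k, Z k h ^ 2 + 2 * L ^ 2 * n := by
            rw [Finset.sum_add_distrib, ← Finset.mul_sum]
            simp
            ring
        _ ≤ _ := by gcongr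
    have hdiag : (1 - pHat y) * ∑ h, (∑ k, M k h ^ 2) * x h ^ 2
        ≤ (2 * B + 2 * L ^ 2 * n) * (x ⬝ᵥ x) := by
      have h0 : 0 ≤ ∑ h, (∑ k, M k h ^ 2) * x h ^ 2 := by positivity
      calc _ ≤ 1 * ∑ h, (∑ k, M k h ^ 2) * x h ^ 2 := by gcongr; linarith
        _ ≤ ∑ h, (2 * B + 2 * L ^ 2 * n) * x h ^ 2 := by
          rw [one_mul]
          exact Finset.sum_le_sum fun h _ => by gcongr; exact hcol h
        _ = _ := by simp only [dotProduct, Finset.mul_sum, sq]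
    rw [dotProduct_sigmaHat_mulVec]
    have h1 := mul_le_mul_of_nonneg_right hlow (hnn x)
    have h2 := mul_le_mul_of_nonneg_left hsig (by positivity : 0 ≤ p ^ 2 / 2)
    have h3 : p ^ 2 / 2 * (n * d / c ^ 2 * (x ⬝ᵥ x))
        = p ^ 2 * (n * d) / (2 * c ^ 2) * (x ⬝ᵥ x) := by
      field_simp
    linarith
  · -- On the kernel of the signal only the centred part contributes.
    have hMx : M *ᵥ x = Z *ᵥ x := by
      rw [hMZ, Matrix.add_mulVec, Matrix.smul_mulVec, hM₀mul, hx, mul_zero, Matrix.mulVec_zero,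
        smul_zero, add_zero]
    have h0 : 0 ≤ (1 - pHat y) * ∑ h, (∑ k, M k h ^ 2) * x h ^ 2 :=
      mul_nonneg (by linarith) (by positivity)
    have hpos : 0 < x ⬝ᵥ x := lt_of_le_of_ne (hnn x) fun h => hx0 (dotProduct_self_eq_zero.1 h.symm)
    rw [dotProduct_sigmaHat_mulVec, hMx]
    have := mul_lt_mul_of_pos_right hupp hpos
    linarith [hZ x]

/-! ### Concentration of the centred matrix -/

/-- With probability at least `1 - exp (-n)`, the operator norm of `M - p M₀` is of order `√n`. The
union bound runs over `5 ^ d * 5 ^ n ≤ exp (4 n)` pairs of net points, and `t ^ 2 = 10 s n` makes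
each tail `exp (-5 n)`. -/
theorem exists_event_centered_bound {n d : ℕ} (hdn : d ≤ n) {Ω : Type*} [MeasurableSpace Ω]
    {P : Measure Ω} [IsProbabilityMeasure P] {p σ L : ℝ} {τ : ℝ≥0} (hL : 0 < L)
    {M₀ : Matrix (Fin n) (Fin d) ℝ} (hM₀ : ∀ k h, |M₀ k h| ≤ L)
    {ε y : Ω → Matrix (Fin n) (Fin d) ℝ} (hε : IsNoise P σ τ ε) (hy : IsMask P p y)
    (hεy : IndepFun (fun ω (e : Fin n × Fin d) => ε ω e.1 e.2)
      (fun ω (e : Fin n × Fin d) => y ω e.1 e.2) P) :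
    ∃ G : Set Ω, MeasurableSet G ∧ P.real Gᶜ ≤ Real.exp (-n) ∧ ∀ ω ∈ G, ∀ x : Fin d → ℝ,
      ((observed M₀ (ε ω) (y ω) - p • M₀) *ᵥ x) ⬝ᵥ ((observed M₀ (ε ω) (y ω) - p • M₀) *ᵥ x)
        ≤ 160 * (√τ + L) ^ 2 * n * (x ⬝ᵥ x) := by
  set s : ℝ := (√τ + L) ^ 2 with hs
  have hs0 : 0 < s := by positivity
  let Z : Ω → Matrix (Fin n) (Fin d) ℝ := fun ω => observed M₀ (ε ω) (y ω) - p • M₀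
  obtain ⟨N, hNcard, hN1, hN⟩ := exists_half_net (EuclideanSpace ℝ (Fin d))
  obtain ⟨N', hNcard', hN1', hN'⟩ := exists_half_net (EuclideanSpace ℝ (Fin n))
  rw [finrank_euclideanSpace_fin] at hNcard hNcard'
  set t := √(10 * s * n) with ht
  have htsq : t ^ 2 = 10 * s * n := Real.sq_sqrt (by positivity)
  let lin : EuclideanSpace ℝ (Fin d) × EuclideanSpace ℝ (Fin n) → Ω → ℝ := fun q ω =>
    ∑ e : Fin n × Fin d, (q.2 e.1 * q.1 e.2) * Z ω e.1 e.2
  have hlin : ∀ q ω, lin q ω = q.2.ofLp ⬝ᵥ Z ω *ᵥ q.1.ofLp := by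
    intro q ω
    simp only [lin, Fintype.sum_prod_type, dotProduct, Matrix.mulVec, Finset.mul_sum]
    exact Finset.sum_congr rfl fun k _ => Finset.sum_congr rfl fun h _ => by ring
  have hmeas : ∀ q, Measurable (lin q) := by
    intro q
    refine Finset.measurable_sum _ fun e _ => measurable_const.mul ?_
    exact ((hy.measurable e.1 e.2).mul (measurable_const.add (hε.measurable e.1 e.2))).sub
      measurable_const
  refine ⟨(⋃ q ∈ N ×ˢ N', {ω | t ≤ lin q ω})ᶜ, ?_, ?_, ?_⟩
  · exact (Finset.measurableSet_biUnion _ fun q _ =>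
      measurableSet_le measurable_const (hmeas q)).compl
  · rw [compl_compl]
    have htail : ∀ q ∈ N ×ˢ N', P.real {ω | t ≤ lin q ω} ≤ Real.exp (-(5 * n)) := by
      intro q hq
      rw [Finset.mem_product] at hq
      have hq2 : ∑ e : Fin n × Fin d, (q.2 e.1 * q.1 e.2) ^ 2 ≤ 1 := by
        simp only [Fintype.sum_prod_type, mul_pow, ← Finset.mul_sum, ← Finset.sum_mul]
        rw [← EuclideanSpace.real_norm_sq_eq, ← EuclideanSpace.real_norm_sq_eq]
        exact mul_le_one₀ (pow_le_one₀ (norm_nonneg _) (hN1' _ hq.2)) (by positivity)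
          (pow_le_one₀ (norm_nonneg _) (hN1 _ hq.1))
      have h := (hasSubgaussianMGF_centered hL hM₀ hε hy hεy hq2).measure_ge_le
        (Real.sqrt_nonneg (10 * s * n))
      refine h.trans_eq ?_
      rw [← ht, htsq]
      congr 1
      simp only [NNReal.coe_pow, NNReal.coe_add, Real.coe_sqrt, Real.coe_toNNReal L hL.le, ← hs]
      field_simp
      ring
    have h5 : (5 : ℝ) ≤ Real.exp 2 := by
      have := Real.quadratic_le_exp_of_nonneg (x := 2) (by norm_num)
      linarith
    have hcard : ((N ×ˢ N').card : ℝ) ≤ Real.exp (4 * n) := by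
      rw [Finset.card_product]
      have h1 : N.card * N'.card ≤ 5 ^ n * 5 ^ n :=
        Nat.mul_le_mul (hNcard.trans (Nat.pow_le_pow_right (by norm_num) hdn)) hNcard'
      calc ((N.card * N'.card : ℕ) : ℝ) ≤ ((5 ^ n * 5 ^ n : ℕ) : ℝ) := by exact_mod_cast h1
        _ = (5 : ℝ) ^ n * 5 ^ n := by push_cast; ring
        _ ≤ Real.exp 2 ^ n * Real.exp 2 ^ n := by gcongr
        _ = Real.exp (4 * n) := by
          rw [← Real.exp_nat_mul, ← Real.exp_add]
          ring_nf
    calc P.real (⋃ q ∈ N ×ˢ N', {ω | t ≤ lin q ω})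
        ≤ ∑ q ∈ N ×ˢ N', P.real {ω | t ≤ lin q ω} := measureReal_biUnion_finset_le _ _
      _ ≤ (N ×ˢ N').card * Real.exp (-(5 * n)) := by
        rw [← nsmul_eq_mul]
        exact Finset.sum_le_card_nsmul _ _ _ htail
      _ ≤ Real.exp (4 * n) * Real.exp (-(5 * n)) := by gcongr
      _ = Real.exp (-n) := by
        rw [← Real.exp_add]
        ring_nf
  · intro ω hω x
    let A : EuclideanSpace ℝ (Fin d) →L[ℝ] EuclideanSpace ℝ (Fin n) :=
      LinearMap.toContinuousLinearMap (Matrix.toLpLin 2 2 (Z ω))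
    have hA : ‖A‖ ≤ 4 * t := by
      refine opNorm_le_of_half_net hN hN' A (Real.sqrt_nonneg _) fun v hv u hu => ?_
      have hlt : lin (v, u) ω < t := by
        by_contra! h
        exact hω (Set.mem_biUnion (Finset.mem_coe.2 (Finset.mk_mem_product hv hu)) h)
      rw [hlin] at hlt
      refine le_trans (le_of_eq ?_) hlt.le
      rw [EuclideanSpace.inner_eq_star_dotProduct, dotProduct_comm]
      simp [A, Matrix.toLpLin_apply]
    have hx := A.le_of_opNorm_le hA (WithLp.toLp 2 x)
    have hAx : (Z ω *ᵥ x) ⬝ᵥ (Z ω *ᵥ x) = ‖A (WithLp.toLp 2 x)‖ ^ 2 := by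
      rw [← dotProduct_self_eq_norm_sq]
      simp [A, Matrix.toLpLin_apply]
    have hxx : x ⬝ᵥ x = ‖WithLp.toLp 2 x‖ ^ 2 := by
      rw [← dotProduct_self_eq_norm_sq]
    change (Z ω *ᵥ x) ⬝ᵥ (Z ω *ᵥ x) ≤ _
    rw [hAx, hxx]
    calc ‖A (WithLp.toLp 2 x)‖ ^ 2 ≤ (4 * t * ‖WithLp.toLp 2 x‖) ^ 2 := by gcongr
      _ = 16 * t ^ 2 * ‖WithLp.toLp 2 x‖ ^ 2 := by ring
      _ = _ := by rw [htsq]; ring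

/-- Only `G` has to be measurable; the measurability of `S` plays no role. -/
theorem abs_measureReal_sub_one_le {Ω : Type*} [MeasurableSpace Ω] {P : Measure Ω}
    [IsProbabilityMeasure P] {S G : Set Ω} (hG : MeasurableSet G) (hGS : G ⊆ S) :
    |P.real S - 1| ≤ P.real Gᶜ := by
  rw [probReal_compl_eq_one_sub hG, abs_sub_comm,
    abs_of_nonneg (sub_nonneg.2 measureReal_le_one)]
  exact sub_le_sub_left (measureReal_mono hGS) 1

end LowRank

theorem lemma2 (p σ L c α : ℝ) (τ : ℝ≥0) (hp0 : 0 < p) (hp1 : p ≤ 1) (hL : 0 < L) (hc : 0 < c)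
    (hα : α < 1) (C : ℕ → ℝ) (hC : Tendsto C atTop atTop)
    (hCd : Tendsto (fun d : ℕ => C d / (d : ℝ)) atTop (𝓝 0)) (δ : ℝ) (hδ : 0 < δ) :
    ∃ K : ℝ, ∀ n d r : ℕ, 0 < d → d ≤ n → (n : ℝ) ≤ Real.exp ((d : ℝ) ^ α) →
      ∀ M₀ : Matrix (Fin n) (Fin d) ℝ, LowRank.IsSignal r L c M₀ →
      ∀ (Ω : Type*) [MeasurableSpace Ω] (P : Measure Ω) [IsProbabilityMeasure P]
        (ε y : Ω → Matrix (Fin n) (Fin d) ℝ),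
        LowRank.IsNoise P σ τ ε → LowRank.IsMask P p y →
        IndepFun (fun ω (e : Fin n × Fin d) => ε ω e.1 e.2)
          (fun ω (e : Fin n × Fin d) => y ω e.1 e.2) P →
        |P.real {ω | LowRank.rankEstimator p (C d)
            (LowRank.observed M₀ (ε ω) (y ω)) (y ω) = r} - 1| ≤ K * (n : ℝ) ^ (-δ) := by
  set s : ℝ := (√τ + L) ^ 2
  have hs0 : 0 < s := by positivity
  have hp2 : 0 < p ^ 2 := by positivity
  have hdlarge : Tendsto (fun d : ℕ => (d : ℝ)) atTop atTop := tendsto_natCast_atTop_atTop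
  -- From `d₀` on, the threshold `p² n C d` lies strictly between the upper bound `160 s n` on
  -- the kernel of the signal and the lower bound of order `n d` on its row space.
  obtain ⟨d₀, hd₀⟩ := eventually_atTop.1
    ((hC.eventually_gt_atTop (160 * s / p ^ 2)).and
      ((hCd.eventually_le_const (u := 1 / (4 * c ^ 2)) (by positivity)).and
        (hdlarge.eventually_ge_atTop ((480 * s + 2 * L ^ 2) * (4 * c ^ 2) / p ^ 2))))
  refine ⟨Real.exp (d₀ * δ) + δ ^ δ, ?_⟩
  intro n d r hd hdn hn M₀ hM₀ Ω _ P _ ε y hε hy hεy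
  have hn0 : (0 : ℝ) < n := by exact_mod_cast hd.trans_le hdn
  have hd1 : (1 : ℝ) ≤ d := by exact_mod_cast hd
  have hnδ : 0 < (n : ℝ) ^ (-δ) := by positivity
  have hδδ : 0 < δ ^ δ := by positivity
  rw [add_mul]
  rcases lt_or_ge d d₀ with hlt | hge
  · -- For bounded `d` also `n` is bounded, and the trivial bound `1` suffices.
    have hnd₀ : (n : ℝ) ≤ Real.exp d₀ := by
      refine hn.trans (Real.exp_le_exp.2 ?_)
      calc (d : ℝ) ^ α ≤ (d : ℝ) ^ (1 : ℝ) := Real.rpow_le_rpow_of_exponent_le hd1 hα.le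
        _ = d := Real.rpow_one _
        _ ≤ d₀ := by exact_mod_cast hlt.le
    have h1 : 1 ≤ Real.exp (d₀ * δ) * (n : ℝ) ^ (-δ) := by
      rw [Real.rpow_neg hn0.le, ← div_eq_mul_inv, one_le_div (by positivity), Real.exp_mul]
      gcongr
    have h2 := LowRank.abs_measureReal_sub_one_le (P := P) MeasurableSet.empty
      (Set.empty_subset {ω | LowRank.rankEstimator p (C d)
        (LowRank.observed M₀ (ε ω) (y ω)) (y ω) = r})
    rw [Set.compl_empty, probReal_univ] at h2
    have := mul_pos hδδ hnδ
    linarith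
  · obtain ⟨hCbig, hCsmall, hdbig⟩ := hd₀ d hge
    obtain ⟨G, hG, hGP, hGZ⟩ := LowRank.exists_event_centered_bound hdn hL hM₀.bounded hε hy hεy
    refine (LowRank.abs_measureReal_sub_one_le hG fun ω hω => ?_).trans (hGP.trans ?_)
    · refine LowRank.rankEstimator_eq_of_centered_bound (B := 160 * s * n)
        (pow_le_one₀ hp0.le hp1) hc hM₀ (hy.zero_or_one ω) (hGZ ω hω) ?_ ?_
      · rw [div_lt_iff₀ hp2] at hCbig
        nlinarith
      · rw [div_le_div_iff₀ (by positivity) (by positivity), one_mul] at hCsmall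
        rw [div_le_iff₀ hp2] at hdbig
        have h1 : p ^ 2 * C d ≤ p ^ 2 * d / (4 * c ^ 2) := by
          rw [le_div_iff₀ (by positivity), mul_assoc]
          gcongr
        have h2 : 480 * s + 2 * L ^ 2 ≤ p ^ 2 * d / (4 * c ^ 2) := by
          rw [le_div_iff₀ (by positivity)]
          linarith
        have h3 : p ^ 2 * (n * d) / (2 * c ^ 2)
            = (p ^ 2 * d / (4 * c ^ 2) + p ^ 2 * d / (4 * c ^ 2)) * n := by
          field_simp
          ring
        rw [h3]
        nlinarith
    · -- `n / δ ≤ exp (n / δ)`, raised to the power `δ`.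
      have h1 : ((n : ℝ) / δ) ^ δ ≤ Real.exp n := by
        calc ((n : ℝ) / δ) ^ δ ≤ Real.exp (n / δ) ^ δ := by
              gcongr
              linarith [Real.add_one_le_exp ((n : ℝ) / δ)]
          _ = Real.exp n := by rw [← Real.exp_mul, div_mul_cancel₀ _ hδ.ne']
      rw [Real.div_rpow hn0.le hδ.le, div_le_iff₀ hδδ] at h1
      have h2 : Real.exp (-n) ≤ δ ^ δ * (n : ℝ) ^ (-δ) := by
        rw [Real.rpow_neg hn0.le, ← div_eq_mul_inv, le_div_iff₀ (by positivity), Real.exp_neg,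
          inv_mul_le_iff₀ (Real.exp_pos _)]
        exact h1
      have := mul_pos (Real.exp_pos (d₀ * δ)) hnδ
      linarith
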